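/- Let $G$ be a compact connected Lie group with its Borel $\sigma$-algebra. Let $\operatorname{Irr}(G)$ be the set of equivalence classes of irreducible unitary representations of $G$ (continuous homomorphisms $G \to U(d)$, $d \ge 1$, for which $\{0\}$ and $\mathbb{C}^d$ are the only invariant subspaces; two of them are equivalent if they are intertwined by an invertible linear map). For every $\delta \in \operatorname{Irr}(G)$ fix a unitary representation $U^\delta : G \to U(d_\delta)$ in the class $\delta$. For a $G$-valued random variable $X$ on a probability space $(\Omega, \mathcal{A}, \mathbb{P})$, let $\phi_X(\delta) = \mathbb{E}(U^\delta(X)) \in \mathbb{C}^{d_\delta \times d_\delta}$ be its characteristic function. Call $X$ inverse invariant if $X \stackrel{d}{=} X^{-1}$, and conjugate invariant if $X \stackrel{d}{=} kXk^{-1}$ for all $k \in G$. Then the following hold. 1. $X$ is inverse invariant if and only if $\phi_X(\delta)$ is Hermitian for all $\delta \in \operatorname{Irr}(G)$. 2. If $X$ is inverse invariant and $X_1, \ldots, X_n$ are independent copies of $X$, then the product $X_1 \cdots X_n$ is inverse invariant. 3. $X$ is conjugate invariant if and only if for every $\delta \in \operatorname{Irr}(G)$ there is $a_\delta \in \mathbb{C}$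 with $\phi_X(\delta) = a_\delta I_{d_\delta}$, where $I_{d_\delta}$ is the $d_\delta \times d_\delta$ identity matrix. 4. If $X$ and $Y$ are independent $G$-valued random variables on $\Omega$ and both are conjugate invariant, then $XY$ is conjugate invariant. 5. $X$ is conjugate invariant if and only if $XY \stackrel{d}{=} YX$ for every $G$-valued random variable $Y$ on $\Omega$ independent of $X$. -/

import Mathlib

open MeasureTheory ProbabilityTheory
open scoped Manifold

universe u

noncomputable section

namespace CompactLie

/-- The representation of `G` on `ℂ ^ d` defined by a homomorphism into the unitary group `U(d)`. -/
def matrixRep {G : Type*} [Group G] {d : ℕ} (π : G →* Matrix.unitaryGroup (Fin d) ℂ) :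
    Representation ℂ G (Fin d → ℂ) where
  toFun g := Matrix.toLin' (π g : Matrix (Fin d) (Fin d) ℂ)
  map_one' := by simp; rfl
  map_mul' g h := by simp [Matrix.toLin'_mul]; rfl

/-- An irreducible unitary representation of `G`: a continuous homomorphism into `U(d)`, without
invariant subspaces other than `0` and `ℂ ^ d` (and `d ≠ 0`, which is part of `IsIrreducible`). -/
structure IrrUnitaryRep (G : Type*) [Group G] [TopologicalSpace G] where
  /-- the dimension -/
  dim : ℕ
  /-- the continuous homomorphism -/
  hom : G →ₜ* Matrix.unitaryGroup (Fin dim) ℂ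
  irreducible : (matrixRep (hom : G →* Matrix.unitaryGroup (Fin dim) ℂ)).IsIrreducible

namespace IrrUnitaryRep

variable {G : Type*} [Group G] [TopologicalSpace G]

/-- The matrix `U(g)`. -/
def mat (U : IrrUnitaryRep G) (g : G) : Matrix (Fin U.dim) (Fin U.dim) ℂ :=
  (U.hom g : Matrix (Fin U.dim) (Fin U.dim) ℂ)

/-- The underlying linear representation on `ℂ ^ d`. -/
def rep (U : IrrUnitaryRep G) : Representation ℂ G (Fin U.dim → ℂ) :=
  matrixRep (U.hom : G →* Matrix.unitaryGroup (Fin U.dim) ℂ)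

end IrrUnitaryRep

/-- Equivalence of representations: there is an invertible linear map `L` with
`L ∘ U₁(g) = U₂(g) ∘ L` for all `g`. -/
instance irrSetoid (G : Type*) [Group G] [TopologicalSpace G] : Setoid (IrrUnitaryRep G) where
  r U₁ U₂ := Nonempty (U₁.rep.Equiv U₂.rep)
  iseqv :=
    { refl := fun U => ⟨Representation.Equiv.refl U.rep⟩
      symm := fun ⟨e⟩ => ⟨e.symm⟩
      trans := fun ⟨e⟩ ⟨f⟩ => ⟨e.trans f⟩ }

/-- `Irr(G)`: the set of equivalence classes of irreducible (unitary) representations of `G`. -/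
def Irr (G : Type u) [Group G] [TopologicalSpace G] : Type u := Quotient (irrSetoid G)

/-- A choice, for every `δ ∈ Irr(G)`, of a unitary representation `U^δ` in the class `δ`. -/
structure Representatives (G : Type*) [Group G] [TopologicalSpace G] where
  /-- the representation `U^δ` -/
  U : Irr G → IrrUnitaryRep G
  mem_class : ∀ δ : Irr G, Quotient.mk (irrSetoid G) (U δ) = δ

instance (G : Type*) [Group G] [TopologicalSpace G] : Nonempty (Representatives G) :=
  ⟨⟨fun δ => Quotient.out δ, fun δ => Quotient.out_eq δ⟩⟩

section RandomVariables

variable {G Ω : Type*} [Group G] [MeasurableSpace Ω]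

/-- The characteristic function `φ_X(δ) = 𝔼(U^δ(X))` (entrywise expectation; the entries are
bounded). -/
def charFn [TopologicalSpace G] (R : Representatives G) (P : Measure Ω) (X : Ω → G) (δ : Irr G) :
    Matrix (Fin (R.U δ).dim) (Fin (R.U δ).dim) ℂ :=
  Matrix.of fun i j => ∫ ω, (R.U δ).mat (X ω) i j ∂P

/-- `X` and `X⁻¹` have the same distribution. -/
def InverseInvariant [MeasurableSpace G] (P : Measure Ω) (X : Ω → G) : Prop :=
  IdentDistrib X (fun ω => (X ω)⁻¹) P P

/-- `X` and `k X k⁻¹` have the same distribution, for every fixed `k ∈ G`. -/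
def ConjugateInvariant [MeasurableSpace G] (P : Measure Ω) (X : Ω → G) : Prop :=
  ∀ k : G, IdentDistrib X (fun ω => k * X ω * k⁻¹) P P

end RandomVariables

end CompactLie

end

/-!
The two criteria in terms of `φ_X` reduce to the uniqueness theorem `CompactLie.ext_of_charFn`: a
finite measure on a compact group is determined by the integrals of the entries of the irreducible
unitary representations. Indeed `φ` of `X⁻¹` is the adjoint of `φ_X`, and `φ` of `k X k⁻¹` is
`U(k) φ_X U(k)⁻¹`, so that invariance under conjugation means that `φ_X(δ)` commutes with the
irreducible `U^δ`, that is, is scalar by Schur's lemma. The assertions on products of independent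
variables are elementary statements about product measures and do not use representations.

The uniqueness theorem is a form of the Peter–Weyl theorem. For a strongly continuous unitary
representation `ρ` of a compact group and a vector `u ≠ 0`, the average over Haar measure of the
rank-one operators `⟪ρ(x) u, ·⟫ ρ(x) u` is a nonzero compact self-adjoint operator commuting with
`ρ`. An eigenspace for a nonzero eigenvalue is finite-dimensional and invariant, and a minimal
invariant subspace of it is irreducible and not orthogonal to `u`
(`CompactLie.exists_isIrreducibleSubspace_not_orthogonal`). For the regular representation on
`L²(G)`, apply this to `u = ∫ ρ(x)⁻¹ f dμ(x) - ∫ ρ(x)⁻¹ f dν(x)`: if `μ` and `ν` have the same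
characteristic function, then `u` is orthogonal to every finite-dimensional irreducible subspace, so
`u = 0`; taking `f` continuous gives `∫ f dμ = ∫ f dν`
(`CompactLie.ext_of_integral_regularRep`).
-/

noncomputable section

namespace CompactLie

/-! ### Irreducible subspaces of unitary representations of compact groups -/

section Averaging

open InnerProductSpace Module.End

lemma integrable_of_continuous_of_compact {G F : Type*} [TopologicalSpace G] [CompactSpace G]
    [SecondCountableTopology G] [MeasurableSpace G] [BorelSpace G] [NormedAddCommGroup F]
    (m : Measure G) [IsFiniteMeasure m] {f : G → F} (hf : Continuous f) :
    Integrable f m := by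
  obtain ⟨C, hC⟩ := isCompact_univ.exists_bound_of_continuousOn hf.continuousOn
  exact Integrable.of_bound hf.aestronglyMeasurable C (.of_forall fun x => hC x trivial)

variable {G : Type*} [Group G]
  {H : Type*} [NormedAddCommGroup H] [InnerProductSpace ℂ H] {ρ : G →* (H ≃ₗᵢ[ℂ] H)} {u : H}

/-- A nonzero invariant subspace of a unitary representation without proper nonzero invariant
subspaces. -/
structure IsIrreducibleSubspace (ρ : G →* (H ≃ₗᵢ[ℂ] H)) (W : Submodule ℂ H) : Prop where
  ne_bot : W ≠ ⊥
  invariant : ∀ x, ∀ v ∈ W, ρ x v ∈ W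
  eq_bot_or_eq : ∀ V ≤ W, (∀ x, ∀ v ∈ V, ρ x v ∈ V) → V = ⊥ ∨ V = W

lemma exists_isIrreducibleSubspace_le {K : Submodule ℂ H} [FiniteDimensional ℂ K] (hK : K ≠ ⊥)
    (hinv : ∀ x, ∀ v ∈ K, ρ x v ∈ K) :
    ∃ W ≤ K, IsIrreducibleSubspace ρ W := by
  obtain ⟨W, ⟨hWK, hW, hWi⟩, hmin⟩ := exists_minimalFor_of_wellFoundedLT
    (fun V : Submodule ℂ H => V ≤ K ∧ V ≠ ⊥ ∧ ∀ x, ∀ v ∈ V, ρ x v ∈ V)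
    (fun V => Module.finrank ℂ V) ⟨K, le_rfl, hK, hinv⟩
  have : FiniteDimensional ℂ W := Submodule.finiteDimensional_of_le hWK
  refine ⟨W, hWK, hW, hWi, fun V hV hVi => or_iff_not_imp_left.2 fun hV0 => ?_⟩
  exact Submodule.eq_of_le_of_finrank_le hV
    (hmin ⟨hV.trans hWK, hV0, hVi⟩ (Submodule.finrank_mono hV))

/-- The average `∫ ⟪ρ x u, ·⟫ ρ x u dm(x)` of the rank-one operators along the orbit of `u` under
the unitary representation `ρ`, as a Bochner integral in the space of bounded operators. -/
def orbitAverage [MeasurableSpace G] (m : Measure G) (ρ : G →* (H ≃ₗᵢ[ℂ] H)) (u : H) : H →L[ℂ] H :=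
  ∫ x, rankOne ℂ (ρ x u) (ρ x u) ∂m

variable [TopologicalSpace G] [CompactSpace G] [SecondCountableTopology G]
  [MeasurableSpace G] [BorelSpace G] {m : Measure G} [IsProbabilityMeasure m]

lemma integrable_rankOne_orbit (hρ : Continuous fun x => ρ x u) :
    Integrable (fun x => rankOne ℂ (ρ x u) (ρ x u)) m := by
  refine integrable_of_continuous_of_compact m ?_
  simp only [rankOne_def']
  exact ((ContinuousLinearMap.toSpanSingletonCLE (𝕜 := ℂ) (E := H)).continuous.comp hρ).clm_comp
    ((innerSL ℂ).continuous.comp hρ)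

lemma orbitAverage_apply (hρ : Continuous fun x => ρ x u) (v : H) :
    orbitAverage m ρ u v = ∫ x, inner ℂ (ρ x u) v • ρ x u ∂m := by
  rw [orbitAverage, ContinuousLinearMap.integral_apply (integrable_rankOne_orbit hρ)]
  simp

variable [CompleteSpace H]

lemma inner_orbitAverage (hρ : Continuous fun x => ρ x u) (v w : H) :
    inner ℂ w (orbitAverage m ρ u v) = ∫ x, inner ℂ (ρ x u) v * inner ℂ w (ρ x u) ∂m := by
  rw [orbitAverage_apply hρ, ← integral_inner]
  · simp [inner_smul_right]
  · exact integrable_of_continuous_of_compact m ((hρ.inner continuous_const).smul hρ)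

lemma isCompactOperator_orbitAverage (hρ : Continuous fun x => ρ x u) :
    IsCompactOperator (orbitAverage m ρ u) := by
  -- An average of finite-rank operators stays in the closed convex set of compact operators.
  have hconv : Convex ℝ {f : H →L[ℂ] H | IsCompactOperator f} := by
    intro f hf g hg a b _ _ _
    simp only [Set.mem_ofPred_eq] at *
    have h := (hf.smul (a : ℂ)).add (hg.smul (b : ℂ))
    have e : ⇑(a • f + b • g) = (a : ℂ) • ⇑f + (b : ℂ) • ⇑g := by
      funext v; simp
    rwa [← e] at h
  refine hconv.integral_mem isClosed_setOfPred_isCompactOperator (.of_forall fun x => ?_)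
    (integrable_rankOne_orbit hρ)
  show IsCompactOperator (rankOne ℂ (ρ x u) (ρ x u))
  rw [rankOne_def']
  exact (isCompactOperator_of_locallyCompactSpace_rng
    (ContinuousLinearMap.toSpanSingleton ℂ (ρ x u))).comp_clm (innerSL ℂ (ρ x u))

lemma isSymmetric_orbitAverage (hρ : Continuous fun x => ρ x u) :
    (orbitAverage m ρ u : H →ₗ[ℂ] H).IsSymmetric := by
  intro v w
  show inner ℂ (orbitAverage m ρ u v) w = inner ℂ v (orbitAverage m ρ u w)
  rw [← inner_conj_symm, inner_orbitAverage hρ, inner_orbitAverage hρ, ← integral_conj]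
  refine integral_congr_ae (.of_forall fun x => ?_)
  simp [mul_comm]

lemma orbitAverage_comm [IsTopologicalGroup G] [m.IsMulLeftInvariant]
    (hρ : Continuous fun x => ρ x u) (z : G) (v : H) :
    orbitAverage m ρ u (ρ z v) = ρ z (orbitAverage m ρ u v) := by
  rw [orbitAverage_apply hρ, orbitAverage_apply hρ,
    ← integral_mul_left_eq_self (μ := m) _ z]
  have h := ((ρ z).toContinuousLinearEquiv : H →L[ℂ] H).integral_comp_comm
    (integrable_of_continuous_of_compact m
      ((hρ.inner (𝕜 := ℂ) (continuous_const (y := v))).smul hρ))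
  refine Eq.trans ?_ h
  refine integral_congr_ae (.of_forall fun x => ?_)
  simp

/-- The quadratic form of `orbitAverage m ρ u` vanishes at `v` only if `v` is orthogonal to almost
all of the orbit of `u`. -/
lemma inner_orbitAverage_self (hρ : Continuous fun x => ρ x u) (v : H) :
    inner ℂ v (orbitAverage m ρ u v) = ((∫ x, ‖inner ℂ v (ρ x u)‖ ^ 2 ∂m : ℝ) : ℂ) := by
  rw [inner_orbitAverage hρ, ← integral_complex_ofReal]
  refine integral_congr_ae (.of_forall fun x => ?_)
  simp only [← inner_conj_symm (ρ x u) v]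
  push_cast
  exact RCLike.conj_mul _

lemma orbitAverage_ne_zero [m.IsOpenPosMeasure] (hρ : Continuous fun x => ρ x u) (hu : u ≠ 0) :
    orbitAverage m ρ u ≠ 0 := by
  intro h0
  have h := inner_orbitAverage_self (m := m) hρ u
  rw [h0] at h
  have hc : Continuous fun x => ‖inner ℂ u (ρ x u)‖ ^ 2 := by fun_prop
  have h2 : ∫ x, ‖inner ℂ u (ρ x u)‖ ^ 2 ∂m = 0 := by exact_mod_cast (by simpa using h.symm)
  rw [integral_eq_zero_iff_of_nonneg (fun x => by positivity)
    (integrable_of_continuous_of_compact m hc),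
    hc.ae_eq_iff_eq m continuous_zero] at h2
  have h3 := congrFun h2 1
  simp [hu] at h3

/-- Finite-dimensional irreducible subspaces of a strongly continuous unitary representation of a
compact group span a dense subspace: no nonzero vector `u` is orthogonal to all of them. They are
found inside an eigenspace of the compact self-adjoint operator `orbitAverage m ρ u`. -/
theorem exists_isIrreducibleSubspace_not_orthogonal [IsTopologicalGroup G]
    (hρ : ∀ v, Continuous fun x => ρ x v) (hu : u ≠ 0) :
    ∃ W : Submodule ℂ H, FiniteDimensional ℂ W ∧ IsIrreducibleSubspace ρ W ∧
      ∃ w ∈ W, inner ℂ u w ≠ 0 := by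
  let m : Measure G := Measure.haarMeasure ⊤
  have : IsProbabilityMeasure m := ⟨Measure.haarMeasure_self (K₀ := ⊤)⟩
  have h1 := ContinuousLinearMap.eq_zero_of_forall_hasEigenvalue_eq_zero
    (isCompactOperator_orbitAverage (m := m) (hρ u)) (isSymmetric_orbitAverage (hρ u))
  have h2 : ¬ ∀ μ, HasEigenvalue (orbitAverage m ρ u : Module.End ℂ H) μ → μ = 0 :=
    fun h => orbitAverage_ne_zero (hρ u) hu (h1.1 h)
  push Not at h2
  obtain ⟨c, hc, hc0⟩ := h2
  have := ContinuousLinearMap.finite_dimensional_eigenspace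
    (isCompactOperator_orbitAverage (m := m) (hρ u)) c hc0
  obtain ⟨W, hWK, hW⟩ := exists_isIrreducibleSubspace_le (ρ := ρ) hc fun x v hv => by
    rw [mem_eigenspace_iff] at hv ⊢
    have := orbitAverage_comm (m := m) (hρ u) x v
    simp_all
  have hWf : FiniteDimensional ℂ W := Submodule.finiteDimensional_of_le hWK
  refine ⟨W, hWf, hW, ?_⟩
  -- If `W ⟂ u`, invariance makes `W` orthogonal to the whole orbit of `u`, so `orbitAverage`
  -- vanishes on `W`, whereas it acts there as the nonzero scalar `c`.
  by_contra! hcon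
  obtain ⟨w, hwW, hw⟩ := W.ne_bot_iff.1 hW.ne_bot
  have h4 := inner_orbitAverage_self (m := m) (hρ u) w
  have h5 : orbitAverage m ρ u w = c • w := mem_eigenspace_iff.1 (hWK hwW)
  have h6 : ∀ x, inner ℂ w (ρ x u) = 0 := by
    intro x
    have h7 := hcon (ρ x⁻¹ w) (hW.invariant _ _ hwW)
    rw [← inner_conj_symm, map_eq_zero, ← LinearIsometryEquiv.inner_map_map (ρ x⁻¹)]
    simpa using h7
  simp [h5, h6, hc0, hw] at h4

end Averaging

/-! ### Matrix coefficients on irreducible subspaces -/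

section Coefficients

variable {G : Type*} [Group G]
  {H : Type*} [NormedAddCommGroup H] [InnerProductSpace ℂ H] {ρ : G →* (H ≃ₗᵢ[ℂ] H)}
  {W : Submodule ℂ H}

/-- The restriction of a unitary representation to an irreducible subspace. -/
def IsIrreducibleSubspace.restrict (hW : IsIrreducibleSubspace ρ W) : Representation ℂ G W where
  toFun x := ((ρ x).toLinearEquiv : H →ₗ[ℂ] H).restrict (hW.invariant x)
  map_one' := by ext; simp
  map_mul' x y := by ext; simp

lemma IsIrreducibleSubspace.coe_restrict_apply (hW : IsIrreducibleSubspace ρ W) (x : G) (w : W) :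
    (hW.restrict x w : H) = ρ x w := rfl

/-- The matrix of the action on an irreducible subspace in an orthonormal basis. -/
def IsIrreducibleSubspace.unitaryHom {d : ℕ} (hW : IsIrreducibleSubspace ρ W)
    (b : OrthonormalBasis (Fin d) ℂ W) : G →* Matrix.unitaryGroup (Fin d) ℂ :=
  have hstar (x : G) : star (LinearMap.toMatrix b.toBasis b.toBasis (hW.restrict x)) =
      LinearMap.toMatrix b.toBasis b.toBasis (hW.restrict x⁻¹) := by
    ext i j
    rw [Matrix.star_apply, LinearMap.toMatrix_apply, LinearMap.toMatrix_apply,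
      b.coe_toBasis_repr_apply, b.coe_toBasis_repr_apply, b.repr_apply_apply, b.repr_apply_apply]
    simp only [OrthonormalBasis.coe_toBasis, Submodule.coe_inner, hW.coe_restrict_apply]
    rw [RCLike.star_def, inner_conj_symm, ← LinearIsometryEquiv.inner_map_map (ρ x⁻¹)]
    simp
  { toFun x := ⟨LinearMap.toMatrix b.toBasis b.toBasis (hW.restrict x), by
      rw [Matrix.mem_unitaryGroup_iff, hstar, ← LinearMap.toMatrix_mul, ← map_mul]
      simp⟩
    map_one' := by ext1; simp
    map_mul' x y := by ext1; simp [LinearMap.toMatrix_mul] }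

lemma IsIrreducibleSubspace.unitaryHom_apply {d : ℕ} (hW : IsIrreducibleSubspace ρ W)
    (b : OrthonormalBasis (Fin d) ℂ W) (x : G) (i j : Fin d) :
    (hW.unitaryHom b x : Matrix (Fin d) (Fin d) ℂ) i j = inner ℂ (b i : H) (ρ x (b j)) := by
  show LinearMap.toMatrix b.toBasis b.toBasis (hW.restrict x) i j = _
  rw [LinearMap.toMatrix_apply, b.coe_toBasis_repr_apply, b.repr_apply_apply]
  simp [hW.coe_restrict_apply]

lemma IsIrreducibleSubspace.equivFun_restrict {d : ℕ} (hW : IsIrreducibleSubspace ρ W)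
    (b : OrthonormalBasis (Fin d) ℂ W) (x : G) (w : W) :
    b.toBasis.equivFun (hW.restrict x w) =
      matrixRep (hW.unitaryHom b) x (b.toBasis.equivFun w) :=
  (LinearMap.toMatrix_mulVec_repr b.toBasis b.toBasis (hW.restrict x) w).symm

lemma IsIrreducibleSubspace.isIrreducible_unitaryHom {d : ℕ} (hW : IsIrreducibleSubspace ρ W)
    (b : OrthonormalBasis (Fin d) ℂ W) : (matrixRep (hW.unitaryHom b)).IsIrreducible where
  exists_pair_ne := by
    refine ⟨⊥, ⊤, fun h => hW.ne_bot ?_⟩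
    have h' : (⊥ : Submodule ℂ (Fin d → ℂ)) = ⊤ := congrArg Subrepresentation.toSubmodule h
    refine (Submodule.eq_bot_iff _).2 fun w hw => ?_
    have : b.toBasis.equivFun ⟨w, hw⟩ ∈ (⊥ : Submodule ℂ (Fin d → ℂ)) := h' ▸ Submodule.mem_top
    simpa using this
  eq_bot_or_eq_top S := by
    let e := b.toBasis.equivFun
    -- The subspace of `W` whose coordinate vectors lie in `S`.
    let V : Submodule ℂ H := (S.toSubmodule.comap (e : W →ₗ[ℂ] Fin d → ℂ)).map W.subtype
    have hV (w : W) : (w : H) ∈ V ↔ e w ∈ S.toSubmodule := by simp [V]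
    have hinv : ∀ x, ∀ v ∈ V, ρ x v ∈ V := by
      rintro x _ ⟨w, hw, rfl⟩
      refine (hV (hW.restrict x w)).2 ?_
      rw [hW.equivFun_restrict b]
      exact S.apply_mem_toSubmodule x hw
    rcases hW.eq_bot_or_eq V (Submodule.map_subtype_le _ _) hinv with h | h
    · left
      apply Subrepresentation.toSubmodule_injective
      refine (Submodule.eq_bot_iff _).2 fun c hc => ?_
      have := (hV (e.symm c)).2 (by simpa using hc)
      simpa [h] using this
    · right
      apply Subrepresentation.toSubmodule_injective
      refine Submodule.eq_top_iff'.2 fun c => ?_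
      have := (hV (e.symm c)).1 (by rw [h]; exact (e.symm c).2)
      simpa using this

variable [TopologicalSpace G]

/-- The matrix coefficients of the representation on an irreducible subspace are linear
combinations of the entries of an irreducible unitary matrix representation. -/
theorem IsIrreducibleSubspace.exists_inner_eq_sum_mat [FiniteDimensional ℂ W]
    (hW : IsIrreducibleSubspace ρ W) (hρ : ∀ v, Continuous fun x => ρ x v)
    (v : H) {w : H} (hw : w ∈ W) :
    ∃ (U : IrrUnitaryRep G) (c : Fin U.dim → Fin U.dim → ℂ), ∀ x,
      inner ℂ v (ρ x w) = ∑ i, ∑ j, c i j * U.mat x i j := by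
  let b := stdOrthonormalBasis ℂ W
  have hcont : Continuous (hW.unitaryHom b) := by
    refine continuous_induced_rng.2 (continuous_pi fun i => continuous_pi fun j => ?_)
    simp only [Function.comp_apply, hW.unitaryHom_apply]
    exact continuous_const.inner (hρ _)
  refine ⟨⟨_, ⟨hW.unitaryHom b, hcont⟩, hW.isIrreducible_unitaryHom b⟩,
    fun i j => inner ℂ v (b i : H) * inner ℂ (b j : H) w, fun x => ?_⟩
  have h1 : ρ x w = ∑ j, inner ℂ (b j : H) w • ρ x (b j) := by
    have := congrArg (fun z : W => ρ x z) (b.sum_repr' ⟨w, hw⟩)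
    simpa using this.symm
  have h2 (j) : ρ x (b j) = ∑ i, inner ℂ (b i : H) (ρ x (b j)) • (b i : H) := by
    have := congrArg (fun z : W => (z : H)) (b.sum_repr' (hW.restrict x (b j)))
    simpa [hW.coe_restrict_apply] using this.symm
  rw [h1, inner_sum, Finset.sum_comm]
  refine Finset.sum_congr rfl fun j _ => ?_
  rw [inner_smul_right, h2, inner_sum, Finset.mul_sum]
  refine Finset.sum_congr rfl fun i _ => ?_
  rw [inner_smul_right]
  show _ = _ * (hW.unitaryHom b x : Matrix _ _ ℂ) i j
  rw [hW.unitaryHom_apply]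
  ring

lemma IrrUnitaryRep.continuous_mat (U : IrrUnitaryRep G) (i j : Fin U.dim) :
    Continuous fun x => U.mat x i j :=
  ((continuous_subtype_val.comp U.hom.continuous_toFun).matrix_elem i j)

/-- Every irreducible unitary representation is intertwined with the chosen representative of its
class, so its matrices are those of the representative multiplied by fixed matrices on both
sides. -/
lemma Representatives.exists_mat_eq (R : Representatives G) (U : IrrUnitaryRep G) :
    ∃ (δ : Irr G) (A : Matrix (Fin U.dim) (Fin (R.U δ).dim) ℂ)
      (B : Matrix (Fin (R.U δ).dim) (Fin U.dim) ℂ), ∀ x, U.mat x = A * (R.U δ).mat x * B := by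
  let δ : Irr G := Quotient.mk (irrSetoid G) U
  obtain ⟨e⟩ : Nonempty ((R.U δ).rep.Equiv U.rep) := Quotient.exact (R.mem_class δ)
  refine ⟨δ, LinearMap.toMatrix' (e.toLinearEquiv : _ →ₗ[ℂ] _),
    LinearMap.toMatrix' (e.toLinearEquiv.symm : _ →ₗ[ℂ] _), fun x => ?_⟩
  apply Matrix.toLin'.injective
  rw [Matrix.toLin'_mul, Matrix.toLin'_mul, Matrix.toLin'_toMatrix', Matrix.toLin'_toMatrix']
  refine LinearMap.ext fun c => ?_
  have h := e.toIntertwiningMap.isIntertwining _ _ x (e.symm c)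
  exact (congrArg (U.rep x) (e.apply_symm_apply c)).symm.trans h.symm

end Coefficients

/-! ### The regular representation -/

section RegularRep

open DomMulAct

variable {G : Type*} [Group G] [TopologicalSpace G] [IsTopologicalGroup G] [CompactSpace G]
  [SecondCountableTopology G] [MeasurableSpace G] [BorelSpace G] {m : Measure G} [IsFiniteMeasure m]
  [m.IsMulLeftInvariant]

/-- The left regular representation on `L²(G)`: `(x • f)(y) = f(x⁻¹ y)`. -/
def regularRep (m : Measure G) [m.IsMulLeftInvariant] : G →* (Lp ℂ 2 m ≃ₗᵢ[ℂ] Lp ℂ 2 m) where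
  toFun x :=
    -- `Gᵈᵐᵃ` acts by `(mk c • f)(y) = f(c y)`, which is a right action of `G`.
    { toFun f := mk x⁻¹ • f
      invFun f := mk x • f
      left_inv f := by beta_reduce; rw [smul_smul, ← mk_mul]; simp
      right_inv f := by beta_reduce; rw [smul_smul, ← mk_mul]; simp
      map_add' f g := smul_add _ f g
      map_smul' c f := smul_comm _ c f
      norm_map' f := norm_smul_Lp _ f }
  map_one' := by ext1 f; exact (congrArg (· • f) (by simp)).trans (one_smul Gᵈᵐᵃ f)
  map_mul' x y := by
    ext1 f
    show mk (x * y)⁻¹ • f = mk x⁻¹ • mk y⁻¹ • f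
    rw [smul_smul, ← mk_mul, mul_inv_rev]

lemma continuous_regularRep [m.Regular] (f : Lp ℂ 2 m) : Continuous fun x => regularRep m x f := by
  have : Fact ((2 : ENNReal) ≠ ⊤) := ⟨by simp⟩
  show Continuous fun x : G => mk x⁻¹ • f
  have : Continuous (mk : G → Gᵈᵐᵃ) := continuous_mk
  exact (this.comp continuous_inv).smul continuous_const

lemma regularRep_inv_toLp (f : C(G, ℂ)) (x : G) :
    regularRep m x⁻¹ (ContinuousMap.toLp 2 m ℂ f) =
      ContinuousMap.toLp 2 m ℂ (f.comp (.mulLeft x)) := by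
  show mk x⁻¹⁻¹ • (ContinuousMap.toLp 2 m ℂ f : Lp ℂ 2 m) = _
  rw [inv_inv]
  apply Lp.ext
  refine (smul_Lp_ae_eq _ _).trans ?_
  refine Filter.EventuallyEq.trans ?_ (ContinuousMap.coeFn_toLp m _).symm
  exact (measurePreserving_mul_left m x).quasiMeasurePreserving.ae_eq_comp
    (ContinuousMap.coeFn_toLp m f)

/-- Finite measures are determined by their operators on `L²(G)`: for continuous `f`, the function
`∫ f(x ·) dη(x)` is continuous, hence determined by its class in `L²(G)`, and its value at `1` is
`∫ f dη`. -/
theorem ext_of_integral_regularRep [T2Space G] [m.IsOpenPosMeasure] {μ ν : Measure G}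
    [IsFiniteMeasure μ] [IsFiniteMeasure ν]
    (h : ∀ f : Lp ℂ 2 m, ∫ x, regularRep m x⁻¹ f ∂μ = ∫ x, regularRep m x⁻¹ f ∂ν) : μ = ν := by
  let _ := TopologicalSpace.metrizableSpaceMetric G
  have key (f : C(G, ℂ)) : ∫ x, f x ∂μ = ∫ x, f x ∂ν := by
    let F : G → C(G, ℂ) := fun x => f.comp (.mulLeft x)
    have hF : Continuous F := (ContinuousMap.curry ⟨fun p : G × G => f (p.1 * p.2), by fun_prop⟩).2
    have h1 (η : Measure G) [IsFiniteMeasure η] :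
        ∫ x, regularRep m x⁻¹ (ContinuousMap.toLp 2 m ℂ f) ∂η =
          ContinuousMap.toLp 2 m ℂ (∫ x, F x ∂η) := by
      simp only [regularRep_inv_toLp]
      exact ContinuousLinearMap.integral_comp_comm _ (integrable_of_continuous_of_compact η hF)
    have h2 (η : Measure G) [IsFiniteMeasure η] : (∫ x, F x ∂η) 1 = ∫ x, f x ∂η := by
      have := (ContinuousMap.evalCLM ℂ (1 : G)).integral_comp_comm
        (integrable_of_continuous_of_compact η hF)
      simpa [F] using this.symm
    have h3 := h (ContinuousMap.toLp 2 m ℂ f)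
    rw [h1, h1] at h3
    rw [← h2, ← h2, ContinuousMap.toLp_injective m h3]
  refine ext_of_forall_integral_eq_of_IsFiniteMeasure fun f => ?_
  have := key ⟨fun x => (f x : ℂ), by fun_prop⟩
  simp only [ContinuousMap.coe_mk, integral_complex_ofReal] at this
  exact_mod_cast this

end RegularRep

/-! ### Characteristic functions determine distributions -/

section CharFn

lemma integral_matrix_mul_mul {Ω α β γ κ : Type*} [Fintype β] [Fintype γ] [MeasurableSpace Ω]
    {P : Measure Ω} {M : Ω → Matrix β γ ℂ} (hM : ∀ k l, Integrable (fun ω => M ω k l) P)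
    (A : Matrix α β ℂ) (B : Matrix γ κ ℂ) (i : α) (j : κ) :
    ∫ ω, (A * M ω * B) i j ∂P = (A * (Matrix.of fun k l => ∫ ω, M ω k l ∂P) * B) i j := by
  simp only [Matrix.mul_apply, Matrix.of_apply]
  rw [integral_finsetSum _ fun l _ => (integrable_finsetSum _ fun k _ =>
    (hM k l).const_mul _).mul_const _]
  refine Finset.sum_congr rfl fun l _ => ?_
  rw [integral_mul_const, integral_finsetSum _ fun k _ => (hM k l).const_mul _]
  simp only [integral_const_mul]

lemma charFn_eq_charFn_map {G Ω : Type*} [Group G] [TopologicalSpace G]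
    [MeasurableSpace G] [OpensMeasurableSpace G] [MeasurableSpace Ω] {P : Measure Ω} {X : Ω → G}
    (R : Representatives G) (hX : Measurable X) (δ : Irr G) :
    charFn R P X δ = charFn R (P.map X) id δ := by
  ext i j
  exact (integral_map hX.aemeasurable
    ((R.U δ).continuous_mat i j).aestronglyMeasurable).symm

variable {G : Type*} [Group G] [TopologicalSpace G] [CompactSpace G] [SecondCountableTopology G]
  [MeasurableSpace G] [BorelSpace G]
  {Ω : Type*} [MeasurableSpace Ω] {P : Measure Ω} [IsProbabilityMeasure P] {X : Ω → G}

lemma IrrUnitaryRep.integrable_mat (U : IrrUnitaryRep G) (μ : Measure G) [IsFiniteMeasure μ]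
    (i j : Fin U.dim) : Integrable (fun x => U.mat x i j) μ :=
  integrable_of_continuous_of_compact μ (U.continuous_mat i j)

lemma IrrUnitaryRep.integrable_mat_comp (U : IrrUnitaryRep G) (hX : Measurable X)
    (i j : Fin U.dim) : Integrable (fun ω => U.mat (X ω) i j) P :=
  (U.integrable_mat (P.map X) i j).comp_measurable hX

/-- The characteristic function determines the integrals of all entries of irreducible
representations, not only of the chosen representatives. -/
lemma integral_mat_eq_of_charFn_eq {R : Representatives G} {μ ν : Measure G} [IsFiniteMeasure μ]
    [IsFiniteMeasure ν] (h : ∀ δ, charFn R μ id δ = charFn R ν id δ) (U : IrrUnitaryRep G)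
    (i j : Fin U.dim) : ∫ x, U.mat x i j ∂μ = ∫ x, U.mat x i j ∂ν := by
  obtain ⟨δ, A, B, hAB⟩ := R.exists_mat_eq U
  simp only [hAB]
  rw [integral_matrix_mul_mul ((R.U δ).integrable_mat μ),
    integral_matrix_mul_mul ((R.U δ).integrable_mat ν)]
  exact congrFun (congrFun (congrArg (fun C => A * C * B) (h δ)) i) j

/-- Uniqueness theorem for characteristic functions on a compact group. If the operators
`∫ ρ(x)⁻¹ dμ(x)` and `∫ ρ(x)⁻¹ dν(x)` of the regular representation `ρ` differed at some `f`, the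
difference of their values would be non-orthogonal to a vector `w` of a finite-dimensional
irreducible subspace; but its inner product with `w` is a combination of differences of
characteristic function entries. -/
theorem ext_of_charFn [IsTopologicalGroup G] [T2Space G] {R : Representatives G} {μ ν : Measure G}
    [IsFiniteMeasure μ] [IsFiniteMeasure ν] (h : ∀ δ, charFn R μ id δ = charFn R ν id δ) :
    μ = ν := by
  let m : Measure G := Measure.haarMeasure ⊤
  have hρ := continuous_regularRep (m := m)
  refine ext_of_integral_regularRep (m := m) fun f => ?_
  have hf : Continuous fun x => regularRep m x⁻¹ f := (hρ f).comp continuous_inv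
  rw [← sub_eq_zero]
  by_contra hu
  obtain ⟨W, _, hW, w, hw, hne⟩ := exists_isIrreducibleSubspace_not_orthogonal hρ hu
  obtain ⟨U, c, hc⟩ := hW.exists_inner_eq_sum_mat hρ f hw
  have hint (η : Measure G) [IsFiniteMeasure η] :
      inner ℂ (∫ x, regularRep m x⁻¹ f ∂η) w = ∑ i, ∑ j, c i j * ∫ x, U.mat x i j ∂η := by
    have hi (x : G) : inner ℂ (regularRep m x⁻¹ f) w = ∑ i, ∑ j, c i j * U.mat x i j := by
      rw [← hc, ← LinearIsometryEquiv.inner_map_map (regularRep m x)]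
      simp
    rw [← inner_conj_symm, ← integral_inner (integrable_of_continuous_of_compact η hf),
      ← integral_conj]
    simp only [inner_conj_symm, hi]
    rw [integral_finsetSum _ fun i _ => integrable_finsetSum _ fun j _ =>
      (U.integrable_mat η i j).const_mul _]
    refine Finset.sum_congr rfl fun i _ => ?_
    rw [integral_finsetSum _ fun j _ => (U.integrable_mat η i j).const_mul _]
    simp only [integral_const_mul]
  apply hne
  rw [inner_sub_left, hint, hint, sub_eq_zero]
  simp only [integral_mat_eq_of_charFn_eq h]

theorem identDistrib_iff_charFn [IsTopologicalGroup G] [T2Space G] (R : Representatives G)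
    {Y : Ω → G} (hX : Measurable X) (hY : Measurable Y) :
    IdentDistrib X Y P P ↔ ∀ δ, charFn R P X δ = charFn R P Y δ := by
  refine ⟨fun h δ => ?_, fun h => ⟨hX.aemeasurable, hY.aemeasurable, ?_⟩⟩
  · rw [charFn_eq_charFn_map R hX, charFn_eq_charFn_map R hY, h.map_eq]
  · have := Measure.isProbabilityMeasure_map (μ := P) hX.aemeasurable
    have := Measure.isProbabilityMeasure_map (μ := P) hY.aemeasurable
    refine ext_of_charFn (R := R) fun δ => ?_
    rw [← charFn_eq_charFn_map R hX, ← charFn_eq_charFn_map R hY, h δ]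

/-! ### Invariance in terms of characteristic functions -/

lemma IrrUnitaryRep.mat_mul {G : Type*} [Group G] [TopologicalSpace G] (U : IrrUnitaryRep G)
    (x y : G) : U.mat (x * y) = U.mat x * U.mat y := by
  simp [IrrUnitaryRep.mat]

lemma IrrUnitaryRep.mat_inv {G : Type*} [Group G] [TopologicalSpace G] (U : IrrUnitaryRep G)
    (x : G) : U.mat x⁻¹ = (U.mat x).conjTranspose := by
  simp [IrrUnitaryRep.mat, Matrix.star_eq_conjTranspose]

lemma IrrUnitaryRep.mat_mul_mat_inv {G : Type*} [Group G] [TopologicalSpace G]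
    (U : IrrUnitaryRep G) (x : G) : U.mat x * U.mat x⁻¹ = 1 := by
  rw [← U.mat_mul]
  simp [IrrUnitaryRep.mat]

/-- **Schur's lemma**: a matrix commuting with an irreducible representation is scalar. -/
lemma IrrUnitaryRep.eq_smul_one_of_commute {G : Type*} [Group G] [TopologicalSpace G]
    (U : IrrUnitaryRep G) {A : Matrix (Fin U.dim) (Fin U.dim) ℂ}
    (hA : ∀ x, A * U.mat x = U.mat x * A) : ∃ a : ℂ, A = a • 1 := by
  let f : U.rep.IntertwiningMap U.rep := ⟨Matrix.toLin' A, fun x => by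
    have := congrArg Matrix.toLin' (hA x)
    rwa [Matrix.toLin'_mul, Matrix.toLin'_mul] at this⟩
  have : U.rep.IsIrreducible := U.irreducible
  obtain ⟨a, ha⟩ :=
    Representation.IsIrreducible.algebraMap_intertwiningMap_bijective_of_isAlgClosed.2 f
  refine ⟨a, Matrix.toLin'.injective ?_⟩
  have h2 : Matrix.toLin' A = a • LinearMap.id :=
    (congrArg Representation.IntertwiningMap.toLinearMap ha).symm
  rw [h2]
  simp

lemma charFn_inv {G Ω : Type*} [Group G] [TopologicalSpace G] [MeasurableSpace Ω]
    (R : Representatives G) (P : Measure Ω) (X : Ω → G) (δ : Irr G) :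
    charFn R P (fun ω => (X ω)⁻¹) δ = (charFn R P X δ).conjTranspose := by
  ext i j
  simp only [charFn, Matrix.of_apply, Matrix.conjTranspose_apply, IrrUnitaryRep.mat_inv]
  exact integral_conj

lemma charFn_conj (R : Representatives G) (hX : Measurable X) (k : G) (δ : Irr G) :
    charFn R P (fun ω => k * X ω * k⁻¹) δ =
      (R.U δ).mat k * charFn R P X δ * (R.U δ).mat k⁻¹ := by
  ext i j
  simp only [charFn, Matrix.of_apply, IrrUnitaryRep.mat_mul]
  exact integral_matrix_mul_mul ((R.U δ).integrable_mat_comp hX) _ _ i j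

variable [IsTopologicalGroup G] [T2Space G]

theorem inverseInvariant_iff_isHermitian (R : Representatives G) (hX : Measurable X) :
    InverseInvariant P X ↔ ∀ δ, (charFn R P X δ).IsHermitian := by
  refine (identDistrib_iff_charFn R hX hX.inv).trans ?_
  show (∀ δ, _ = charFn R P (fun ω => (X ω)⁻¹) δ) ↔ _
  simp only [charFn_inv, Matrix.IsHermitian, eq_comm]

theorem conjugateInvariant_iff_charFn_scalar (R : Representatives G) (hX : Measurable X) :
    ConjugateInvariant P X ↔ ∀ δ, ∃ a : ℂ, charFn R P X δ = a • 1 := by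
  have hk (k : G) := identDistrib_iff_charFn (P := P) R hX ((hX.const_mul k).mul_const k⁻¹)
  simp only [ConjugateInvariant, hk, charFn_conj R hX]
  refine ⟨fun h δ => (R.U δ).eq_smul_one_of_commute fun k => ?_, fun h k δ => ?_⟩
  · have hinv := (R.U δ).mat_mul_mat_inv k⁻¹
    rw [inv_inv] at hinv
    conv_lhs => rw [h k δ]
    rw [Matrix.mul_assoc, hinv, Matrix.mul_one]
  · obtain ⟨a, ha⟩ := h δ
    rw [ha, Matrix.mul_smul, Matrix.mul_one, Matrix.smul_mul, IrrUnitaryRep.mat_mul_mat_inv]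

end CharFn

/-! ### Products of independent variables -/

section Products

variable {G : Type*} [Group G] [MeasurableSpace G] [MeasurableMul₂ G]
  {Ω : Type*} [MeasurableSpace Ω] {P : Measure Ω} [IsProbabilityMeasure P] {X Y : Ω → G}

lemma measurable_prod_ofFn (n : ℕ) : Measurable fun z : Fin n → G => (List.ofFn z).prod := by
  induction n with
  | zero => simp
  | succ n ih =>
    simp only [List.ofFn_succ, List.prod_cons]
    exact (measurable_pi_apply 0).mul
      (ih.comp (measurable_pi_lambda _ fun i => measurable_pi_apply i.succ))

/-- The joint law `μⁿ` of the factors is preserved by inverting all coordinates and reversing their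
order, which turns the product into its inverse. -/
theorem InverseInvariant.prod_of_iIndepFun [MeasurableInv G] {Ω' : Type*} [MeasurableSpace Ω']
    {P' : Measure Ω'} [IsProbabilityMeasure P'] (hX : Measurable X)
    (hinv : InverseInvariant P X) {n : ℕ} {Z : Fin n → Ω' → G} (hZ : ∀ i, Measurable (Z i))
    (hind : iIndepFun Z P') (hid : ∀ i, IdentDistrib (Z i) X P' P) :
    InverseInvariant P' (fun ω => (List.ofFn fun i => Z i ω).prod) := by
  let μ := P.map X
  have : IsProbabilityMeasure μ := Measure.isProbabilityMeasure_map hX.aemeasurable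
  have hjoint : P'.map (fun ω i => Z i ω) = Measure.pi fun _ => μ := by
    rw [hind.map_fun_eq_pi_map fun i => (hZ i).aemeasurable]
    exact congrArg Measure.pi (funext fun i => (hid i).map_eq)
  have hμ : MeasurePreserving (fun g : G => g⁻¹) μ μ := by
    refine ⟨measurable_inv, ?_⟩
    rw [Measure.map_map measurable_inv hX]
    exact hinv.map_eq.symm
  have hrev : MeasurePreserving (fun (z : Fin n → G) (i : Fin n) => (z i.rev)⁻¹)
      (Measure.pi fun _ => μ) (Measure.pi fun _ => μ) := by
    have h1 := measurePreserving_piCongrLeft (fun _ : Fin n => μ) Fin.revPerm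
    have h2 := measurePreserving_pi (fun _ : Fin n => μ) (fun _ => μ) fun _ => hμ
    have h := h2.comp h1
    convert h using 1
    funext z i
    have h3 := Equiv.piCongrLeft_apply_apply (fun _ => G) Fin.revPerm z i.rev
    rw [Fin.revPerm_apply, Fin.rev_rev] at h3
    exact congrArg (·⁻¹) h3.symm
  have hprod := measurable_prod_ofFn (G := G) n
  have hZm : Measurable fun ω i => Z i ω := measurable_pi_lambda _ hZ
  have hm : Measurable fun ω => (List.ofFn fun i => Z i ω).prod := hprod.comp hZm
  refine ⟨hm.aemeasurable, hm.inv.aemeasurable, ?_⟩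
  have hinvprod (z : Fin n → G) :
      (List.ofFn z).prod⁻¹ = (List.ofFn fun i : Fin n => (z i.rev)⁻¹).prod := by
    rw [List.prod_inv_reverse]
    congr 1
    refine List.ext_getElem (by simp) fun i h1 h2 => ?_
    simp only [List.getElem_reverse, List.getElem_map, List.getElem_ofFn, List.length_map,
      List.length_ofFn]
    congr 2
    ext
    simp [Fin.val_rev]
    omega
  have e1 : P'.map (fun ω => (List.ofFn fun i => Z i ω).prod) =
      (Measure.pi fun _ => μ).map fun z : Fin n → G => (List.ofFn z).prod := by
    rw [← hjoint, Measure.map_map hprod hZm]; rfl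
  have e2 : P'.map (fun ω => (List.ofFn fun i => Z i ω).prod⁻¹) =
      (Measure.pi fun _ => μ).map
        fun z : Fin n → G => (List.ofFn fun i : Fin n => (z i.rev)⁻¹).prod := by
    have hprod' : Measurable fun z : Fin n → G =>
        (List.ofFn fun i : Fin n => (z i.rev)⁻¹).prod := hprod.comp hrev.measurable
    simp only [hinvprod]
    rw [← hjoint, Measure.map_map hprod' hZm]; rfl
  rw [e1, e2]
  conv_lhs => rw [← hrev.map_eq]
  rw [Measure.map_map hprod hrev.measurable]
  rfl

theorem ConjugateInvariant.mul_of_indepFun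
    (hXY : IndepFun X Y P) (hXc : ConjugateInvariant P X) (hYc : ConjugateInvariant P Y) :
    ConjugateInvariant P (fun ω => X ω * Y ω) := by
  intro k
  have hm : Measurable fun g : G => k * g * k⁻¹ := by fun_prop
  have h := ((hXc k).prodMk (hYc k) hXY (hXY.comp hm hm)).comp
    (u := fun p : G × G => p.1 * p.2) measurable_mul
  have e : (fun ω => k * (X ω * Y ω) * k⁻¹) =
      (fun p : G × G => p.1 * p.2) ∘ fun ω => (k * X ω * k⁻¹, k * Y ω * k⁻¹) := by
    funext ω
    simp only [Function.comp_apply]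
    group
  exact e ▸ h

/-- Invariance under conjugation by `y` says that `X y` and `y X` have the same law; integrate over
the law of an independent `Y` in one direction, and take `Y` constant in the other. -/
theorem conjugateInvariant_iff_mul_comm (hX : Measurable X) :
    ConjugateInvariant P X ↔ ∀ Y : Ω → G, Measurable Y → IndepFun X Y P →
      IdentDistrib (fun ω => X ω * Y ω) (fun ω => Y ω * X ω) P P := by
  constructor
  · intro hc Y hY hXY
    refine ⟨(hX.mul hY).aemeasurable, (hY.mul hX).aemeasurable, ?_⟩
    have := Measure.isProbabilityMeasure_map (μ := P) hX.aemeasurable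
    have := Measure.isProbabilityMeasure_map (μ := P) hY.aemeasurable
    have hfib (y : G) : (P.map X).map (· * y) = (P.map X).map (y * ·) := by
      conv_lhs => rw [(hc y).map_eq]
      rw [Measure.map_map (by fun_prop) (by fun_prop), Measure.map_map (by fun_prop) hX]
      congr 1
      funext ω
      simp
    have h1 : P.map (fun ω => X ω * Y ω) = (P.map X).mconv (P.map Y) :=
      hXY.map_mul_eq_map_mconv_map hX hY
    have h2 : P.map (fun ω => Y ω * X ω) = (P.map Y).mconv (P.map X) :=
      hXY.symm.map_mul_eq_map_mconv_map hY hX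
    rw [h1, h2]
    ext s hs
    rw [Measure.mconv, Measure.mconv, Measure.map_apply measurable_mul hs,
      Measure.map_apply measurable_mul hs, Measure.prod_apply_symm (measurable_mul hs),
      Measure.prod_apply (measurable_mul hs)]
    refine lintegral_congr fun y => ?_
    have h3 := congrArg (fun η => η s) (hfib y)
    rwa [Measure.map_apply (by fun_prop) hs, Measure.map_apply (by fun_prop) hs] at h3
  · intro h k
    have h1 := (h (fun _ => k) measurable_const (indepFun_const_right X k)).comp
      (u := (· * k⁻¹)) (by fun_prop)
    simpa only [Function.comp_def, mul_inv_cancel_right] using h1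

end Products

end CompactLie

end

theorem proposition2
    -- a compact connected Lie group, with its Borel sigma-algebra
    {E : Type*} [NormedAddCommGroup E] [NormedSpace ℝ E] [FiniteDimensional ℝ E]
    {G : Type*} [Group G] [TopologicalSpace G] [ChartedSpace E G] [LieGroup 𝓘(ℝ, E) ((⊤ : ℕ∞) : WithTop ℕ∞) G]
    [T2Space G] [CompactSpace G] [ConnectedSpace G] [MeasurableSpace G] [BorelSpace G]
    -- an arbitrary choice of unitary representatives of the classes in Irr(G)
    (R : CompactLie.Representatives G)
    -- a random variable with values in G
    {Ω : Type*} [MeasurableSpace Ω] (P : Measure Ω) [IsProbabilityMeasure P]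
    (X : Ω → G) (hX : Measurable X)
    -- a second probability space, on which the independent copies of X are defined
    {Ω' : Type*} [MeasurableSpace Ω'] (P' : Measure Ω') [IsProbabilityMeasure P'] :
    (CompactLie.InverseInvariant P X ↔
      ∀ δ : CompactLie.Irr G, (CompactLie.charFn R P X δ).IsHermitian) ∧
    (CompactLie.InverseInvariant P X →
      ∀ (n : ℕ) (Z : Fin n → Ω' → G), (∀ i, Measurable (Z i)) → iIndepFun Z P' →
        (∀ i, IdentDistrib (Z i) X P' P) →
        CompactLie.InverseInvariant P' (fun ω => (List.ofFn fun i => Z i ω).prod)) ∧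
    (CompactLie.ConjugateInvariant P X ↔
      ∀ δ : CompactLie.Irr G, ∃ a : ℂ,
        CompactLie.charFn R P X δ =
          a • (1 : Matrix (Fin (R.U δ).dim) (Fin (R.U δ).dim) ℂ)) ∧
    (∀ Y : Ω → G, Measurable Y → IndepFun X Y P →
      CompactLie.ConjugateInvariant P X → CompactLie.ConjugateInvariant P Y →
      CompactLie.ConjugateInvariant P (fun ω => X ω * Y ω)) ∧
    (CompactLie.ConjugateInvariant P X ↔
      ∀ Y : Ω → G, Measurable Y → IndepFun X Y P →
        IdentDistrib (fun ω => X ω * Y ω) (fun ω => Y ω * X ω) P P) := by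
  have : SecondCountableTopology G := ChartedSpace.secondCountable_of_sigmaCompact E G
  have : IsTopologicalGroup G := topologicalGroup_of_lieGroup 𝓘(ℝ, E) ((⊤ : ℕ∞) : WithTop ℕ∞)
  exact ⟨CompactLie.inverseInvariant_iff_isHermitian R hX,
    fun h n Z hZ hind hid => h.prod_of_iIndepFun hX hZ hind hid,
    CompactLie.conjugateInvariant_iff_charFn_scalar R hX,
    fun Y _ hXY hXc hYc => hXc.mul_of_indepFun hXY hYc,
    CompactLie.conjugateInvariant_iff_mul_comm hX⟩
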